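/- Let $k$ be an algebraically closed field, let $G$ be a finite group and let $H\le G$ be a subgroup. For a projective module $P$ and a finitely generated module $U$ over a finite-dimensional $k$-algebra $A$, with $P\neq 0$, write $[P\,|\,U]^A$ for the multiplicity of $P$ as a direct summand of $U$, that is, the largest integer $n\ge 0$ such that the direct sum $P^{n}$ of $n$ copies of $P$ is isomorphic to a direct summand of $U$ (this is a finite number). Let $S$ be a simple $kG$-module and $T$ a simple $kH$-module, and let $P(S)$ and $P(T)$ be projective covers of $S$ (over $kG$) and of $T$ (over $kH$); here a projective cover of a module is a projective module together with a surjection onto the given module whose kernel $K$ is superfluous (no proper submodule $N$ satisfies $N+K=P$, where $P$ is the projective module). Then $$[P(T)\,|\,S{\downarrow}_H]^{kH}=[P(S)\,|\,T{\uparrow}^G]^{kG},$$ where $S{\downarrow}_H$ is the restriction of $S$ to $H$ and $T{\uparrow}^G$ is the $kG$-module induced from $T$. -/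

import Mathlib

open scoped MonoidAlgebra

/-- `π : P → S` is a projective cover of the `R`-module `S`: the module `P` is projective and `π` is
a surjection with superfluous kernel, i.e. no proper submodule `N` of `P` satisfies
`N + ker π = P`. -/
structure IsProjectiveCover (R : Type*) [Ring R] {P S : Type*} [AddCommGroup P] [Module R P]
    [AddCommGroup S] [Module R S] (π : P →ₗ[R] S) : Prop where
  projective : Module.Projective R P
  surjective : Function.Surjective π
  superfluous : ∀ N : Submodule R P, N ⊔ LinearMap.ker π = ⊤ → N = ⊤

/-- `N` is isomorphic to a direct summand of `U`: there is a split injection from `N` to `U`. -/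
def IsDirectSummand (R : Type*) [Ring R] (N U : Type*) [AddCommGroup N] [Module R N]
    [AddCommGroup U] [Module R U] : Prop :=
  ∃ (i : N →ₗ[R] U) (r : U →ₗ[R] N), r ∘ₗ i = LinearMap.id

/-- The multiplicity `[P | U]` of `P` as a direct summand of `U`: the supremum in `ℕ∞` of the
`n` such that the direct sum of `n` copies of `P` is isomorphic to a direct summand of `U`. -/
noncomputable def summandMultiplicity (R : Type*) [Ring R] (P U : Type*) [AddCommGroup P]
    [Module R P] [AddCommGroup U] [Module R U] : ℕ∞ :=
  ⨆ (n : ℕ) (_ : IsDirectSummand R (Fin n → P) U), (n : ℕ∞)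

/-! Since `k` is algebraically closed, Schur's lemma makes `[P(T) | U]` the dimension of the space
of maps `U → T` that factor through `P(T) → T` (`isDirectSummand_pi_iff`). By a Higman-type
criterion these are the sums of conjugates `∑ g a g⁻¹` of linear maps `a`, so the multiplicity is
the rank of the norm on `Hom_k(U, T)`. The trace form makes the norms on `Hom(U, V)` and `Hom(V, U)`
adjoint, so `U` and `V` may be swapped; Frobenius reciprocity matches the norm images. Hence both
sides equal the rank of the norm on `Hom_k(T, S↓)`. -/

section Superfluous

variable {R : Type*} [Ring R] {P T : Type*} [AddCommGroup P] [Module R P]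
  [AddCommGroup T] [Module R T] {π : P →ₗ[R] T}

/-- The image of the kernel of a projective cover under any linear map is superfluous. -/
lemma IsProjectiveCover.eq_top_of_sup_map_ker (hπ : IsProjectiveCover R π) {Q : Type*}
    [AddCommGroup Q] [Module R Q] (i : P →ₗ[R] Q) (N : Submodule R Q)
    (h : N ⊔ (LinearMap.ker π).map i = ⊤) : N = ⊤ := by
  have h1 : N.comap i = ⊤ := by
    apply hπ.superfluous
    rw [eq_top_iff]
    intro p _
    obtain ⟨n, hn, _, ⟨κ, hκ, rfl⟩, hnk⟩ :=
      Submodule.mem_sup.1 (h ▸ Submodule.mem_top : i p ∈ N ⊔ (LinearMap.ker π).map i)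
    refine Submodule.mem_sup.2 ⟨p - κ, ?_, κ, hκ, sub_add_cancel p κ⟩
    have : i (p - κ) = n := by rw [map_sub, ← hnk, add_sub_cancel_right]
    simpa [this] using hn
  rw [← h, left_eq_sup]
  rintro _ ⟨κ, -, rfl⟩
  exact (h1 ▸ Submodule.mem_top : κ ∈ N.comap i)

/-- A linear map to a finite power of a projective cover of `T` is surjective as soon as the
composite map to the power of `T` is. -/
lemma IsProjectiveCover.surjective_pi (hπ : IsProjectiveCover R π) {n : ℕ} {U : Type*}
    [AddCommGroup U] [Module R U] (g : Fin n → U →ₗ[R] P)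
    (h : Function.Surjective (LinearMap.pi fun j => π ∘ₗ g j)) :
    Function.Surjective (LinearMap.pi g) := by
  classical
  -- The kernel of `Pⁿ → Tⁿ` is a finite sum of superfluous submodules, discarded one at a time.
  have key : ∀ s : Finset (Fin n), LinearMap.range (LinearMap.pi g) ⊔
      s.sup (fun j => (LinearMap.ker π).map (LinearMap.single R (fun _ => P) j)) = ⊤ →
      LinearMap.range (LinearMap.pi g) = ⊤ := by
    intro s
    induction s using Finset.induction_on with
    | empty => simp
    | insert a s _ ih =>
      intro hs
      apply ih
      apply hπ.eq_top_of_sup_map_ker (LinearMap.single R (fun _ => P) a)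
      rw [← hs, Finset.sup_insert, sup_assoc]
      congr 1
      rw [sup_comm]
  rw [← LinearMap.range_eq_top]
  apply key Finset.univ
  rw [eq_top_iff]
  intro p _
  obtain ⟨u, hu⟩ := h (fun j => π (p j))
  refine Submodule.mem_sup.2 ⟨LinearMap.pi g u, ⟨u, rfl⟩, p - LinearMap.pi g u, ?_, by abel⟩
  have hsum : p - LinearMap.pi g u =
      ∑ j, LinearMap.single R (fun _ => P) j ((p - LinearMap.pi g u) j) :=
    (Finset.univ_sum_single _).symm
  rw [hsum]
  refine Submodule.sum_mem _ fun j _ => ?_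
  refine Finset.le_sup (f := fun j => (LinearMap.ker π).map (LinearMap.single R (fun _ => P) j))
    (Finset.mem_univ j) ⟨_, ?_, rfl⟩
  have := congr_fun hu j
  simp only [LinearMap.pi_apply, LinearMap.comp_apply] at this
  simp [this]

end Superfluous

/-! ### Multiplicity as the dimension of a space of maps -/

section Multiplicity

variable (k : Type*) [Field k] {R : Type*} [Ring R] [Algebra k R] {P T : Type*}
  [AddCommGroup P] [Module R P] [AddCommGroup T] [Module k T] [Module R T] [IsScalarTower k R T]
  (U : Type*) [AddCommGroup U] [Module k U] [Module R U] [IsScalarTower k R U]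

/-- The `k`-subspace of the linear maps `U → T` which factor through `π : P → T`. -/
def factorsThrough (π : P →ₗ[R] T) : Submodule k (U →ₗ[R] T) where
  carrier := {f | ∃ g : U →ₗ[R] P, π ∘ₗ g = f}
  add_mem' := by
    rintro _ _ ⟨g, rfl⟩ ⟨g', rfl⟩
    exact ⟨g + g', LinearMap.comp_add _ _ _⟩
  zero_mem' := ⟨0, LinearMap.comp_zero _⟩
  smul_mem' := by
    rintro c _ ⟨g, rfl⟩
    refine ⟨g ∘ₗ (c • LinearMap.id), ?_⟩
    ext u
    change π (g (c • u)) = c • π (g u)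
    rw [← algebraMap_smul R c u, map_smul, map_smul, algebraMap_smul]

variable {U}

omit [Module k U] [IsScalarTower k R U] in
/-- Linearly independent maps to a simple module are jointly surjective, over an algebraically
closed field. -/
lemma LinearIndependent.surjective_pi_of_isSimpleModule [IsAlgClosed k] [IsSimpleModule R T]
    [FiniteDimensional k T] {n : ℕ} {f : Fin n → U →ₗ[R] T} (hf : LinearIndependent k f) :
    Function.Surjective (LinearMap.pi f) := by
  classical
  rw [← LinearMap.range_eq_top]
  obtain ⟨N, hN⟩ := exists_isCompl (LinearMap.range (LinearMap.pi f))
  suffices N = ⊥ by simpa [this] using hN.sup_eq_top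
  rw [eq_bot_iff]
  intro x hx
  rw [Submodule.mem_bot]
  ext i
  -- `q` kills the range; by Schur it is `y ↦ ∑ c j • y j`, so it encodes a linear relation among
  -- the `f j`.
  let q : (Fin n → T) →ₗ[R] T :=
    LinearMap.proj i ∘ₗ N.subtype ∘ₗ N.projectionOnto _ hN.symm
  have hq : ∀ u, q (LinearMap.pi f u) = 0 := by
    intro u
    have : N.projectionOnto _ hN.symm (LinearMap.pi f u) = 0 :=
      (Submodule.projectionOnto_apply_eq_zero_iff _).2 ⟨u, rfl⟩
    simp [q, this]
  have hqx : q x = x i := by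
    simp only [q, LinearMap.comp_apply]
    rw [Submodule.projectionOnto_apply_left hN.symm ⟨x, hx⟩]
    rfl
  choose c hc using fun j => (IsSimpleModule.algebraMap_end_bijective_of_isAlgClosed (A := R)
    (V := T) k).2 (q ∘ₗ LinearMap.single R (fun _ => T) j)
  have hqy : ∀ y : Fin n → T, q y = ∑ j, c j • y j := by
    intro y
    conv_lhs => rw [← Finset.univ_sum_single y]
    rw [map_sum]
    refine Finset.sum_congr rfl fun j _ => ?_
    exact (LinearMap.congr_fun (hc j) (y j)).symm
  have hc0 : ∀ j, c j = 0 := by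
    refine Fintype.linearIndependent_iff.1 hf c ?_
    ext u
    have := hq u
    rw [hqy] at this
    simpa using this
  rw [← hqx, hqy]
  simp [hc0]

/-- `Pⁿ` is a direct summand of `U` iff `n` is at most the dimension of the space of maps `U → T`
which factor through the projective cover `π : P → T` of the simple module `T`. -/
lemma isDirectSummand_pi_iff [IsAlgClosed k] [IsSimpleModule R T] [FiniteDimensional k T]
    [FiniteDimensional k U] {π : P →ₗ[R] T} (hπ : IsProjectiveCover R π) (n : ℕ) :
    IsDirectSummand R (Fin n → P) U ↔ n ≤ Module.finrank k (factorsThrough k U π) := by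
  classical
  have : FiniteDimensional k (U →ₗ[R] T) :=
    FiniteDimensional.of_injective (LinearMap.restrictScalarsₗ k R U T k)
      (LinearMap.restrictScalars_injective k)
  constructor
  · rintro ⟨i, r, hir⟩
    -- Evaluating a relation at `i (Pi.single j p)` isolates its `j`-th coefficient.
    have hli : LinearIndependent k (fun j : Fin n =>
        (⟨π ∘ₗ LinearMap.proj j ∘ₗ r, _, rfl⟩ : factorsThrough k U π)) := by
      rw [Fintype.linearIndependent_iff]
      intro c hc j
      by_contra hj
      obtain ⟨t, ht⟩ := @exists_ne T (IsSimpleModule.nontrivial R T) 0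
      obtain ⟨p, rfl⟩ := hπ.surjective t
      have h1 := LinearMap.congr_fun (congr_arg Subtype.val hc) (i (Pi.single j p))
      have h2 : r (i (Pi.single j p)) = Pi.single j p := LinearMap.congr_fun hir _
      simp only [Submodule.coe_sum, Submodule.coe_smul, LinearMap.sum_apply, LinearMap.smul_apply,
        LinearMap.comp_apply, h2, LinearMap.proj_apply, Submodule.coe_zero,
        LinearMap.zero_apply] at h1
      rw [Finset.sum_eq_single j (by intro b _ hb; simp [hb]) (by simp)] at h1
      simp [hj, ht] at h1
    simpa using hli.fintype_card_le_finrank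
  · intro hn
    have := hπ.projective
    let b := Module.finBasis k (factorsThrough k U π)
    let f : Fin n → factorsThrough k U π := b ∘ Fin.castLE hn
    have hf : LinearIndependent k (fun j => (f j : U →ₗ[R] T)) :=
      (b.linearIndependent.comp _ (Fin.castLE_injective hn)).map' (Submodule.subtype _)
        (Submodule.ker_subtype _)
    choose g hg using fun j => (f j).2
    have hs : Function.Surjective (LinearMap.pi g) := by
      apply hπ.surjective_pi
      simp only [hg]
      exact hf.surjective_pi_of_isSimpleModule k
    have : Module.Projective R (Fin n → P) :=
      .of_equiv (DFinsupp.linearEquivFunOnFintype (R := R) (M := fun _ : Fin n => P))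
    obtain ⟨i, hi⟩ := Module.projective_lifting_property (LinearMap.pi g) LinearMap.id hs
    exact ⟨i, LinearMap.pi g, hi⟩

lemma summandMultiplicity_eq_finrank [IsAlgClosed k] [IsSimpleModule R T] [FiniteDimensional k T]
    [FiniteDimensional k U] {π : P →ₗ[R] T} (hπ : IsProjectiveCover R π) :
    summandMultiplicity R P U = Module.finrank k (factorsThrough k U π) := by
  simp only [summandMultiplicity, isDirectSummand_pi_iff k hπ]
  refine le_antisymm (iSup₂_le fun n hn => by exact_mod_cast hn) ?_
  exact le_iSup₂ (f := fun (n : ℕ) (_ : n ≤ Module.finrank k (factorsThrough k U π)) => (n : ℕ∞))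
    _ le_rfl

end Multiplicity

/-! ### Symmetry of the rank of the norm -/

namespace Representation

section Norm

variable {k G U V : Type*} [Field k] [Group G] [Fintype G] [AddCommGroup U] [Module k U]
  [AddCommGroup V] [Module k V] (σ : Representation k G U) (τ : Representation k G V)

lemma norm_linHom_apply (a : U →ₗ[k] V) (u : U) :
    (linHom σ τ).norm a u = ∑ g, τ g (a (σ g⁻¹ u)) := by
  simp [norm]

lemma norm_linHom_apply_apply (a : U →ₗ[k] V) (g : G) (u : U) :
    (linHom σ τ).norm a (σ g u) = τ g ((linHom σ τ).norm a u) := by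
  have h := LinearMap.congr_fun (self_norm_apply (linHom σ τ) g a) (σ g u)
  rw [linHom_apply, LinearMap.comp_apply, LinearMap.comp_apply, inv_self_apply] at h
  exact h.symm

/-- The trace form on `Hom(U, V) × Hom(V, U)` turns the norm map of one space into that of the
other. -/
lemma trace_norm_linHom_comp [FiniteDimensional k U] [FiniteDimensional k V]
    (a : U →ₗ[k] V) (b : V →ₗ[k] U) :
    LinearMap.trace k V ((linHom σ τ).norm a ∘ₗ b) =
      LinearMap.trace k V (a ∘ₗ (linHom τ σ).norm b) := by
  have h1 : (linHom σ τ).norm a ∘ₗ b = ∑ g, τ g ∘ₗ (a ∘ₗ σ g⁻¹ ∘ₗ b) := by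
    ext; simp [norm]
  have h2 : a ∘ₗ (linHom τ σ).norm b = ∑ g, (a ∘ₗ σ g⁻¹ ∘ₗ b) ∘ₗ τ g := by
    ext v
    simp only [norm_linHom_apply, LinearMap.comp_apply, map_sum, LinearMap.sum_apply]
    exact Fintype.sum_equiv (Equiv.inv G) _ _ fun g => by simp
  rw [h1, h2, map_sum, map_sum]
  exact Finset.sum_congr rfl fun g _ => LinearMap.trace_comp_comm' _ _

/-- The norm maps on `Hom(U, V)` and on `Hom(V, U)` have the same rank. -/
lemma finrank_range_norm_linHom_comm [FiniteDimensional k U] [FiniteDimensional k V] :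
    Module.finrank k (LinearMap.range (linHom σ τ).norm) =
      Module.finrank k (LinearMap.range (linHom τ σ).norm) := by
  let B : (U →ₗ[k] V) →ₗ[k] Module.Dual k (V →ₗ[k] U) :=
    (LinearMap.llcomp k V U V).compr₂ (LinearMap.trace k V)
  have hB : ∀ a b, B a b = LinearMap.trace k V (a ∘ₗ b) := fun _ _ => rfl
  have hinj : Function.Injective B := by
    rw [injective_iff_map_eq_zero]
    intro a ha
    ext u
    by_contra hu
    -- Nondegeneracy is tested on rank-one maps: `a ∘ (φ ⊗ u)` has trace `φ (a u)`.
    obtain ⟨φ, hφ⟩ := Module.Projective.exists_dual_eq_one k hu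
    have h := LinearMap.congr_fun ha (φ.smulRight u)
    have h2 : a ∘ₗ φ.smulRight u = φ.smulRight (a u) := by ext; simp
    rw [hB, h2, LinearMap.trace_smulRight, hφ] at h
    exact one_ne_zero h
  have hcomm : B ∘ₗ (linHom σ τ).norm = (linHom τ σ).norm.dualMap ∘ₗ B := by
    ext a b
    exact trace_norm_linHom_comp σ τ a b
  have hsurj : Function.Surjective B := by
    refine (LinearMap.injective_iff_surjective_of_finrank_eq_finrank ?_).1 hinj
    rw [Subspace.dual_finrank_eq, Module.finrank_linearMap, Module.finrank_linearMap, mul_comm]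
  rw [← LinearMap.finrank_range_dualMap_eq_finrank_range (linHom τ σ).norm, ← LinearMap.range_comp_of_range_eq_top
    (linHom τ σ).norm.dualMap (LinearMap.range_eq_top.2 hsurj), ← hcomm, LinearMap.range_comp]
  exact (LinearEquiv.finrank_eq (Submodule.equivMapOfInjective B hinj _))

end Norm

end Representation

/-! ### Factoring through projectives and sums of conjugates -/

section Factor

variable {k G : Type*} [Field k] [Group G] [Fintype G]

/-- The identity of a projective module over a group algebra is a sum of conjugates of a linear
endomorphism. -/
lemma exists_sumOfConjugatesEquivariant_eq_id (P : Type*) [AddCommGroup P] [Module k P]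
    [Module k[G] P] [IsScalarTower k k[G] P] [Module.Projective k[G] P] :
    ∃ e : P →ₗ[k] P, e.sumOfConjugatesEquivariant G = LinearMap.id := by
  classical
  obtain ⟨s, hs⟩ := Module.Projective.out (R := k[G]) (P := P)
  -- `ε` keeps only the coefficient of `1`; its conjugates keep the other coefficients, so they sum
  -- to the identity.
  let ε : k[G] →ₗ[k] k[G] := MonoidAlgebra.lsingle 1 ∘ₗ Finsupp.lapply 1 ∘ₗ
    (MonoidAlgebra.coeffLinearEquiv k).toLinearMap
  have hε : ∀ x : k[G], ∑ g : G, MonoidAlgebra.single g⁻¹ (1 : k) *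
      ε (MonoidAlgebra.single g (1 : k) * x) = x := by
    intro x
    rw [← Equiv.sum_comp (Equiv.inv G)]
    ext h
    simp [ε]
  let E : (P →₀ k[G]) →ₗ[k] (P →₀ k[G]) := Finsupp.mapRange.linearMap ε
  let r : (P →₀ k[G]) →ₗ[k[G]] P := Finsupp.linearCombination k[G] id
  have hE : ∀ x, ∑ g : G, MonoidAlgebra.single g⁻¹ (1 : k) •
      E (MonoidAlgebra.single g (1 : k) • s x) = s x := by
    intro x
    ext1 p
    simpa [E, Finsupp.finsetSum_apply] using hε (s x p)
  refine ⟨r.restrictScalars k ∘ₗ E ∘ₗ s.restrictScalars k, LinearMap.ext fun x => ?_⟩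
  calc _ = r (∑ g : G, MonoidAlgebra.single g⁻¹ (1 : k) •
      E (MonoidAlgebra.single g (1 : k) • s x)) := by
        simp [LinearMap.sumOfConjugatesEquivariant_apply, LinearMap.conjugate_apply]
    _ = x := by rw [hE]; exact hs x

variable {U V : Type*} [AddCommGroup U] [Module k U] [Module k[G] U] [IsScalarTower k k[G] U]
  [AddCommGroup V] [Module k V] [Module k[G] V] [IsScalarTower k k[G] V]
  {P : Type*} [AddCommGroup P] [Module k[G] P]

/-- A homomorphism factors through an epimorphism from a projective module iff it is a sum of
conjugates of a linear map. -/
lemma exists_comp_eq_iff_exists_sumOfConjugatesEquivariant [Module.Projective k[G] P]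
    {π : P →ₗ[k[G]] V} (hπ : Function.Surjective π) (f : U →ₗ[k[G]] V) :
    (∃ g : U →ₗ[k[G]] P, π ∘ₗ g = f) ↔
      ∃ a : U →ₗ[k] V, a.sumOfConjugatesEquivariant G = f := by
  let : Module k P := Module.compHom P (algebraMap k k[G])
  have : IsScalarTower k k[G] P := IsScalarTower.of_algebraMap_smul fun _ _ => rfl
  constructor
  · rintro ⟨g, rfl⟩
    obtain ⟨e, he⟩ := exists_sumOfConjugatesEquivariant_eq_id (k := k) (G := G) P
    refine ⟨π.restrictScalars k ∘ₗ e ∘ₗ g.restrictScalars k, LinearMap.ext fun u => ?_⟩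
    have := congr_arg π (LinearMap.congr_fun he (g u))
    simp only [LinearMap.id_apply] at this
    rw [LinearMap.comp_apply, ← this]
    simp [LinearMap.sumOfConjugatesEquivariant_apply, LinearMap.conjugate_apply]
  · rintro ⟨a, rfl⟩
    -- A section that is only `k`-linear suffices, as `π` commutes with conjugation.
    obtain ⟨s, hs⟩ := (π.restrictScalars k).exists_rightInverse_of_surjective
      (LinearMap.range_eq_top.2 hπ)
    refine ⟨(s ∘ₗ a).sumOfConjugatesEquivariant G, LinearMap.ext fun u => ?_⟩
    have hs' : ∀ v, π (s v) = v := LinearMap.congr_fun hs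
    simp [LinearMap.sumOfConjugatesEquivariant_apply, LinearMap.conjugate_apply, hs']

end Factor

/-! ### Multiplicity as the rank of the norm -/

namespace Representation

section Rank

variable {k G U V : Type*} [Field k] [Group G] [Fintype G] [AddCommGroup U] [Module k U]
  [AddCommGroup V] [Module k V] (σ : Representation k G U) (τ : Representation k G V)

lemma sumOfConjugatesEquivariant_apply_eq_norm (a : U →ₗ[k] V) (u : U) :
    LinearMap.sumOfConjugatesEquivariant (V := τ.asModule) (W := σ.asModule) G
      (τ.asModuleEquiv.symm.toLinearMap ∘ₗ a ∘ₗ σ.asModuleEquiv.toLinearMap)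
      (σ.asModuleEquiv.symm u) = τ.asModuleEquiv.symm ((linHom σ τ).norm a u) := by
  rw [LinearMap.sumOfConjugatesEquivariant_apply, norm_linHom_apply, map_sum,
    ← Equiv.sum_comp (Equiv.inv G)]
  refine Finset.sum_congr rfl fun g _ => ?_
  rw [LinearMap.conjugate_apply, single_smul, single_smul, one_smul, one_smul]
  simp
  rfl

lemma finrank_factorsThrough_eq_finrank_range_norm {P : Type*} [AddCommGroup P] [Module k[G] P]
    [Module.Projective k[G] P] {π : P →ₗ[k[G]] τ.asModule} (hπ : Function.Surjective π) :
    Module.finrank k (factorsThrough k σ.asModule π) =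
      Module.finrank k (LinearMap.range (linHom σ τ).norm) := by
  let r : (σ.asModule →ₗ[k[G]] τ.asModule) →ₗ[k] (U →ₗ[k] V) :=
    ((LinearEquiv.arrowCongr σ.asModuleEquiv τ.asModuleEquiv).toLinearMap ∘ₗ
      LinearMap.restrictScalarsₗ k k[G] σ.asModule τ.asModule k)
  have hr : Function.Injective r :=
    (LinearEquiv.arrowCongr σ.asModuleEquiv τ.asModuleEquiv).injective.comp
      (LinearMap.restrictScalars_injective k)
  have hrange : (factorsThrough k σ.asModule π).map r = LinearMap.range (linHom σ τ).norm := by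
    ext f
    constructor
    · rintro ⟨f, hf, rfl⟩
      obtain ⟨a, rfl⟩ := (exists_comp_eq_iff_exists_sumOfConjugatesEquivariant hπ f).1 hf
      exact ⟨a, LinearMap.ext fun u => (sumOfConjugatesEquivariant_apply_eq_norm σ τ a u).symm⟩
    · rintro ⟨a, rfl⟩
      exact ⟨_, (exists_comp_eq_iff_exists_sumOfConjugatesEquivariant hπ _).2 ⟨_, rfl⟩,
        LinearMap.ext fun u => sumOfConjugatesEquivariant_apply_eq_norm σ τ a u⟩
  rw [← hrange]
  exact LinearEquiv.finrank_eq (Submodule.equivMapOfInjective r hr _)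

/-- An irreducible representation of a finite group is finite-dimensional. -/
lemma IsIrreducible.finiteDimensional (hτ : τ.IsIrreducible) : FiniteDimensional k V := by
  have : IsSimpleModule k[G] τ.asModule := (irreducible_iff_isSimpleModule_asModule τ).1 hτ
  have : Module.Finite k τ.asModule := Module.Finite.trans k[G] _
  exact Module.Finite.equiv τ.asModuleEquiv

/-- The multiplicity of the projective cover of an irreducible representation `τ` in `σ` is the rank
of the norm map on the linear maps from `σ` to `τ`. -/
lemma summandMultiplicity_eq_finrank_range_norm [IsAlgClosed k] [FiniteDimensional k U]
    (hτ : τ.IsIrreducible) {P : Type*} [AddCommGroup P] [Module k[G] P]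
    {π : P →ₗ[k[G]] τ.asModule} (hπ : IsProjectiveCover k[G] π) :
    summandMultiplicity k[G] P σ.asModule =
      Module.finrank k (LinearMap.range (linHom σ τ).norm) := by
  have := hτ.finiteDimensional
  have : IsSimpleModule k[G] τ.asModule := (irreducible_iff_isSimpleModule_asModule τ).1 hτ
  have := hπ.projective
  rw [summandMultiplicity_eq_finrank k hπ,
    finrank_factorsThrough_eq_finrank_range_norm σ τ hπ.surjective]

end Rank

/-! ### Norms and Frobenius reciprocity -/

section Ind

variable {k G : Type*} [Field k] [Group G] {H : Subgroup G} {S T : Type*} [AddCommGroup S]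
  [Module k S] [AddCommGroup T] [Module k T]

lemma indV_mk_one_apply (τ : Representation k H T) (h : H) (t : T) :
    IndV.mk H.subtype τ 1 (τ h t) = ind H.subtype τ h (IndV.mk H.subtype τ 1 t) := by
  rw [ind_mk]
  simp [← Coinvariants.mk_inv_tmul]

/-- The unit `T → Ind T` has a linear retraction which vanishes on the components of `Ind T` indexed
by elements outside `H`. -/
lemma exists_indV_retraction (τ : Representation k H T) :
    ∃ p : IndV H.subtype τ →ₗ[k] T, (∀ t, p (IndV.mk H.subtype τ 1 t) = t) ∧
      ∀ g ∉ H, ∀ t, p (IndV.mk H.subtype τ g t) = 0 := by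
  classical
  -- The inverse reflects that `h ⊗ t` and `1 ⊗ h⁻¹t` agree in the coinvariants.
  refine ⟨Coinvariants.lift _ (TensorProduct.lift <| (Finsupp.lift (T →ₗ[k] T) k G fun g =>
    if hg : g ∈ H then τ ⟨g, hg⟩⁻¹ else 0) ∘ₗ (MonoidAlgebra.coeffLinearEquiv k).toLinearMap)
    fun h => ?_, fun t => ?_, fun g hg t => ?_⟩
  · ext g t
    by_cases hg : g ∈ H
    · have hhg : (h : G) * g ∈ H := H.mul_mem h.2 hg
      have e : (⟨h * g, hhg⟩ : H) = h * ⟨g, hg⟩ := rfl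
      simp [hg, hhg, e, -MulMemClass.mk_mul_mk]
    · have hhg : (h : G) * g ∉ H := fun h' => hg ((H.mul_mem_cancel_left h.2).1 h')
      simp only [LinearMap.coe_comp, Function.comp_apply, MonoidAlgebra.lsingle_apply]
      simp [hg, hhg]
  · have e : (⟨1, H.one_mem⟩ : H) = 1 := rfl
    simp [e, -Submonoid.mk_eq_one, -Subgroup.mk_eq_one]
  · simp [hg]

variable [Fintype G] [Fintype H]

/-- Frobenius reciprocity preserves the rank of the norm map. -/
lemma finrank_range_norm_linHom_ind (σ : Representation k G S) (τ : Representation k H T) :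
    Module.finrank k (LinearMap.range (linHom (ind H.subtype τ) σ).norm) =
      Module.finrank k (LinearMap.range (linHom τ (σ.comp H.subtype)).norm) := by
  classical
  let res : (IndV H.subtype τ →ₗ[k] S) →ₗ[k] (T →ₗ[k] S) :=
    LinearMap.lcomp k S (IndV.mk H.subtype τ 1)
  have hres : ∀ b t, res b t = b (IndV.mk H.subtype τ 1 t) := fun _ _ => rfl
  have hinj : ∀ f ∈ LinearMap.range (linHom (ind H.subtype τ) σ).norm, res f = 0 → f = 0 := by
    rintro _ ⟨b, rfl⟩ hf
    refine IndV.hom_ext _ _ fun g => LinearMap.ext fun t => ?_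
    have h1 : IndV.mk H.subtype τ g t =
        ind H.subtype τ g⁻¹ (IndV.mk H.subtype τ 1 t) := by rw [ind_mk]; simp
    have h2 := LinearMap.congr_fun hf t
    rw [hres] at h2
    rw [LinearMap.comp_apply, h1, norm_linHom_apply_apply, h2]
    simp
  have hrange : (LinearMap.range (linHom (ind H.subtype τ) σ).norm).map res =
      LinearMap.range (linHom τ (σ.comp H.subtype)).norm := by
    apply le_antisymm
    · rintro _ ⟨_, ⟨b, rfl⟩, rfl⟩
      -- Inverses of left coset representatives form a right transversal, so the norm over `G` is
      -- the norm over `H` of a sum over cosets.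
      let e : (G ⧸ H) × H → G := fun x => x.2 * x.1.out⁻¹
      have he : Function.Bijective e := by
        refine ⟨?_, fun g => ?_⟩
        · rintro ⟨q, h⟩ ⟨q', h'⟩ hqh
          have h1 : q.out * (h⁻¹ : H) = q'.out * (h'⁻¹ : H) := by
            simpa [e] using congr_arg (·⁻¹) hqh
          have h2 : q = q' := by
            have := congr_arg (QuotientGroup.mk (s := H)) h1
            rwa [QuotientGroup.mk_mul_of_mem _ (h⁻¹).2, QuotientGroup.mk_mul_of_mem _ (h'⁻¹).2,
              QuotientGroup.out_eq', QuotientGroup.out_eq'] at this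
          subst h2
          simpa using h1
        · obtain ⟨h, hh⟩ := QuotientGroup.mk_out_eq_mul H g⁻¹
          exact ⟨(QuotientGroup.mk g⁻¹, h), by simp [e, hh]⟩
      refine ⟨∑ q : G ⧸ H, σ q.out⁻¹ ∘ₗ b ∘ₗ ind H.subtype τ q.out ∘ₗ IndV.mk H.subtype τ 1,
        LinearMap.ext fun t => ?_⟩
      rw [hres, norm_linHom_apply, norm_linHom_apply, ← he.sum_comp,
        Fintype.sum_prod_type_right]
      refine Finset.sum_congr rfl fun h _ => ?_
      rw [LinearMap.sum_apply, map_sum]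
      refine Finset.sum_congr rfl fun q _ => ?_
      rw [mul_inv_rev, inv_inv, map_mul, map_mul]
      exact congr_arg (fun x => σ h (σ q.out⁻¹ (b (ind H.subtype τ q.out x))))
        (indV_mk_one_apply τ h⁻¹ t)
    · rintro _ ⟨a, rfl⟩
      -- Extending `a` by zero off the `H`-component kills the terms with `g ∉ H`, leaving the norm
      -- over `H`.
      obtain ⟨p, hp, hp'⟩ := exists_indV_retraction τ
      refine ⟨_, ⟨a ∘ₗ p, rfl⟩, LinearMap.ext fun t => ?_⟩
      rw [hres, norm_linHom_apply, norm_linHom_apply]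
      rw [← Finset.sum_subset
        (Finset.subset_univ (Finset.univ.map (Function.Embedding.subtype (· ∈ H))))]
      · rw [Finset.sum_map]
        refine Finset.sum_congr rfl fun h _ => ?_
        have := (indV_mk_one_apply τ h⁻¹ t).symm
        rw [Subgroup.coe_inv] at this
        rw [Function.Embedding.subtype_apply, this, LinearMap.comp_apply, hp]
        rfl
      · intro g _ hg
        have hg : g ∉ H := by simpa using hg
        rw [ind_mk, one_mul, inv_inv, LinearMap.comp_apply, hp' g hg]
        simp
  rw [← hrange]
  refine LinearEquiv.finrank_eq (LinearEquiv.ofBijective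
    (res.submoduleMap _) ⟨?_, res.submoduleMap_surjective _⟩)
  rw [injective_iff_map_eq_zero]
  rintro ⟨f, hf⟩ h
  exact Subtype.ext (hinj f hf (congr_arg Subtype.val h))

end Ind

end Representation

theorem corollary1p2 {k G : Type*} [Field k] [IsAlgClosed k] [Group G] [Finite G]
    (H : Subgroup G)
    {S T : Type*} [AddCommGroup S] [Module k S] [AddCommGroup T] [Module k T]
    (σ : Representation k G S) (hσ : σ.IsIrreducible)
    (τ : Representation k H T) (hτ : τ.IsIrreducible)
    {PS PT : Type*} [AddCommGroup PS] [Module k[G] PS] [AddCommGroup PT] [Module k[H] PT]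
    (πS : PS →ₗ[k[G]] σ.asModule) (hπS : IsProjectiveCover k[G] πS)
    (πT : PT →ₗ[k[H]] τ.asModule) (hπT : IsProjectiveCover k[H] πT) :
    summandMultiplicity k[H] PT (Representation.asModule (σ.comp H.subtype)) =
        summandMultiplicity k[G] PS (Representation.asModule (Representation.ind H.subtype τ)) ∧
      summandMultiplicity k[H] PT (Representation.asModule (σ.comp H.subtype)) ≠ ⊤ := by
  have := Fintype.ofFinite G
  have := Fintype.ofFinite H
  have := hσ.finiteDimensional
  have := hτ.finiteDimensional
  rw [Representation.summandMultiplicity_eq_finrank_range_norm _ τ hτ hπT,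
    Representation.summandMultiplicity_eq_finrank_range_norm _ σ hσ hπS,
    Representation.finrank_range_norm_linHom_ind,
    Representation.finrank_range_norm_linHom_comm]
  exact ⟨rfl, ENat.natCast_ne_top _⟩
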